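/- Let $n\ge 1$ and $1\le i\le n$. Let $e_1,\dots,e_n$ be the standard basis of $\mathbb{C}^n$, let $G=GL(n)$ be the complex general linear group, $B\subset G$ the subgroup of invertible upper triangular matrices, and $S_i=\mathrm{Stab}_B([e_i])$ the stabilizer in $B$ of the line $[e_i]=\mathbb{C}e_i$. Let $\mathcal{B}_n$ be the variety of full flags $\mathcal F=(V_1\subset\dots\subset V_n)$ in $\mathbb{C}^n$ with $\dim V_k=k$, on which $G$ acts naturally; write $\mathcal{F}=(v_1\subset\dots\subset v_n)$ if $V_k=\mathrm{span}\{v_1,\dots,v_k\}$ for all $k$. For $1\le j<i$ let $\hat e_j=e_j+e_i$ (the hat vector of index $j$). A flag is in $i$-standard form if it can be written as $(v_1\subset\dots\subset v_n)$, where each $v_k$ is a standard basis vector $e_{j}$ with $1\le j\le n$ or a hat vector $\hat e_{j}$ with $1\le j<i$, such that (a) $v_k=e_i$ for some $k$; (b) if $v_k=e_i$, then $v_\ell$ is a standard basis vector for every $\ell>k$; (c) if $\ell<k$, $v_\ell=\hat e_{a}$ and $v_k=\hat e_{b}$, then $a>b$. Theorem. Every $S_i$-orbit on $\mathcal{B}_n$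 contains a unique flag in $i$-standard form. Moreover, let an $i$-decorated permutation be a pair $(w,\Delta)$ of a permutation $w$ of $\{1,\dots,n\}$ and a subset $\Delta=\{j_1<\dots<j_k=i\}$ of $\{1,\dots,n\}$, $k\ge1$, with $w^{-1}(j_k)<\dots<w^{-1}(j_1)$. Let $\tau_\Delta$ be the $k$-cycle $(j_k,j_{k-1},\dots,j_1)$, which sends $j_\ell$ to $j_{\ell-1}$ for $\ell>1$ and $j_1$ to $j_k=i$. Then the map $$(w,\Delta)\mapsto \mathcal{F}_{(w,\Delta)}:=(v_1\subset\dots\subset v_n),\qquad v_p=\begin{cases}\hat e_{\tau_\Delta w(p)} & \text{if } \tau_\Delta w(p)\in\Delta\setminus\{i\},\\ e_{\tau_\Delta w(p)} & \text{otherwise,}\end{cases}$$ is a bijection from the set of $i$-decorated permutations onto the set of flags in $i$-standard form, and the $S_i$-orbit of $\mathcal{F}_{(w,\Delta)}$ is $$Q_{(w,\Delta)}=\{\,b\cdot(e_{w(1)}\subset\dots\subset e_{w(n)}) : b\in B,\ b\cdot[v_\Delta]=[e_i]\,\},\qquad v_\Delta=\sum_{j\in\Delta}e_j .$$ -/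

import Mathlib

namespace FlagOrbits

open Matrix

open scoped LinearAlgebra.Projectivization

/-- The standard basis vector `e_j` of `ℂⁿ`. -/
def e {n : ℕ} (j : Fin n) : Fin n → ℂ := Pi.single j 1

theorem e_ne_zero {n : ℕ} (j : Fin n) : e j ≠ 0 := by
  simp [e]

/-- The hat vector of index `j` relative to `i`, namely `e_j + e_i` (used only for `j < i`). -/
def hat {n : ℕ} (i j : Fin n) : Fin n → ℂ := e j + e i

/-- `GL(n)` acts on column vectors by multiplication. -/
instance glAction (n : ℕ) : DistribMulAction (GL (Fin n) ℂ) (Fin n → ℂ) where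
  smul g v := (g : Matrix (Fin n) (Fin n) ℂ) *ᵥ v
  one_smul v := Matrix.one_mulVec v
  mul_smul g h v := (Matrix.mulVec_mulVec v g.val h.val).symm
  smul_zero g := Matrix.mulVec_zero g.val
  smul_add g v w := Matrix.mulVec_add g.val v w

instance glAction_smulCommClass (n : ℕ) : SMulCommClass (GL (Fin n) ℂ) ℂ (Fin n → ℂ) where
  smul_comm g c v := Matrix.mulVec_smul g.val c v

theorem gl_smul_def {n : ℕ} (g : GL (Fin n) ℂ) (v : Fin n → ℂ) :
    g • v = (g : Matrix (Fin n) (Fin n) ℂ) *ᵥ v := rfl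

/-- The standard Borel subgroup `B` of invertible upper triangular matrices. -/
def borel (n : ℕ) : Subgroup (GL (Fin n) ℂ) where
  carrier := {g | ∀ a b : Fin n, b < a → (g : Matrix (Fin n) (Fin n) ℂ) a b = 0}
  one_mem' a b h := Matrix.one_apply_ne h.ne'
  mul_mem' {g h} hg hh a b hab :=
    Matrix.BlockTriangular.mul (b := id) (M := g.val) (N := h.val)
      (fun a b hab => hg a b hab) (fun a b hab => hh a b hab) hab
  inv_mem' {g} hg a b hab := by
    have : Invertible g.val := g.invertible
    have h := Matrix.blockTriangular_inv_of_blockTriangular (b := id) (M := g.val)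
      (fun a b hab => hg a b hab)
    rw [Matrix.coe_units_inv]
    exact h hab

/-- `S_i`, the stabilizer in `B` of the line `[e_i]`. -/
noncomputable def S {n : ℕ} (i : Fin n) : Subgroup (GL (Fin n) ℂ) :=
  borel n ⊓ MulAction.stabilizer (GL (Fin n) ℂ) (Projectivization.mk ℂ (e i) (e_ne_zero i))

/-- Full flags `0 = V₀ ⊂ V₁ ⊂ ⋯ ⊂ Vₙ = ℂⁿ` with `dim V_k = k`. -/
@[ext]
structure FullFlag (n : ℕ) where
  V : Fin (n + 1) → Submodule ℂ (Fin n → ℂ)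
  mono : Monotone V
  finrank_eq : ∀ k, Module.finrank ℂ (V k) = k

namespace FullFlag

open scoped Pointwise

/-- `GL(n)` acts on flags by `g • (V_k)_k = (g V_k)_k`. -/
instance (n : ℕ) : MulAction (GL (Fin n) ℂ) (FullFlag n) where
  smul g F :=
    { V := fun k => g • F.V k
      mono := fun _ _ h => Submodule.map_mono (F.mono h)
      finrank_eq := fun k =>
        (LinearEquiv.finrank_map_eq (DistribMulAction.toLinearEquiv ℂ (Fin n → ℂ) g)
          (F.V k)).trans (F.finrank_eq k) }
  one_smul F := FullFlag.ext (funext fun k => one_smul _ (F.V k))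
  mul_smul g h F := FullFlag.ext (funext fun k => mul_smul g h (F.V k))

theorem smul_V {n : ℕ} (g : GL (Fin n) ℂ) (F : FullFlag n) (k : Fin (n + 1)) :
    (g • F).V k = g • F.V k := rfl

/-- `F = (v₁ ⊂ v₂ ⊂ ⋯ ⊂ vₙ)`: the `k`-th subspace of `F` is the span of the first `k` vectors. -/
def IsSpannedBy {n : ℕ} (F : FullFlag n) (v : Fin n → (Fin n → ℂ)) : Prop :=
  ∀ k : Fin (n + 1), F.V k = Submodule.span ℂ (v '' {p | p.castSucc < k})

/-- `F` is in `i`-standard form. -/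
def IsStandardForm {n : ℕ} (i : Fin n) (F : FullFlag n) : Prop :=
  ∃ v : Fin n → (Fin n → ℂ), F.IsSpannedBy v ∧
    (∀ k, (∃ j, v k = e j) ∨ ∃ j < i, v k = hat i j) ∧
    (∃ k, v k = e i) ∧
    (∀ k, v k = e i → ∀ l, k < l → ∃ j, v l = e j) ∧
    (∀ l k, l < k → ∀ a < i, ∀ b < i, v l = hat i a → v k = hat i b → b < a)

end FullFlag

/-- `(w, Δ)` is a decorated permutation: `Δ` is nonempty and a decreasing sequence for `w⁻¹`. -/
def IsDecorated {n : ℕ} (w : Equiv.Perm (Fin n)) (Δ : Finset (Fin n)) : Prop :=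
  Δ.Nonempty ∧ ∀ a ∈ Δ, ∀ b ∈ Δ, a < b → w⁻¹ b < w⁻¹ a

/-- The set of `i`-decorated permutations: decorated permutations `(w, Δ)` with `max Δ = i`. -/
def IDecorated {n : ℕ} (i : Fin n) : Type :=
  {d : Equiv.Perm (Fin n) × Finset (Fin n) //
    IsDecorated d.1 d.2 ∧ IsGreatest (d.2 : Set (Fin n)) i}

/-- For `Δ = {j₁ < ⋯ < j_k}`, the `k`-cycle `(j_k, j_{k-1}, …, j₁)`, sending `j_l` to `j_{l-1}` for
`l > 1` and `j₁` to `j_k`. -/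
def cyc {n : ℕ} (Δ : Finset (Fin n)) : Equiv.Perm (Fin n) :=
  (Δ.sort (· ≥ ·)).formPerm

/-- The vectors obtained from `e_{τw(1)}, …, e_{τw(n)}`, where `τ` is the cycle of `Δ`, by placing
hats on those with index in `Δ \ {i}`. -/
def stdVec {n : ℕ} (i : Fin n) (w : Equiv.Perm (Fin n)) (Δ : Finset (Fin n)) (p : Fin n) :
    Fin n → ℂ :=
  if cyc Δ (w p) ∈ Δ ∧ cyc Δ (w p) ≠ i then hat i (cyc Δ (w p)) else e (cyc Δ (w p))

/-- The orbit `Q_{(w,Δ)}`: all flags `b • (e_{w(1)} ⊂ ⋯ ⊂ e_{w(n)})` with `b ∈ B` taking the line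
through `v_Δ = ∑_{j ∈ Δ} e_j` to `[e_i]`. -/
def orbitOf {n : ℕ} (i : Fin n) (w : Equiv.Perm (Fin n)) (Δ : Finset (Fin n)) :
    Set (FullFlag n) :=
  {F | ∃ b ∈ borel n, (∃ c : ℂ, c ≠ 0 ∧ b • (∑ j ∈ Δ, e j) = c • e i) ∧
    F.IsSpannedBy fun p => b • e (w p)}

end FlagOrbits

/-!
An `S i`-orbit of flags is the same thing as a `borel n`-orbit of pairs (line, flag) whose line lies
in `borel n • [e i]`: the flag `F` corresponds to the pair `([e i], F)`. The set `orbitOf i w Δ`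
collects the flags `F` for which `([e i], F)` is a translate of the pair formed by the line through
`∑ j ∈ Δ, e j` and the coordinate flag of `w`, so that it is a single orbit as soon as it is
nonempty (`orbit_eq_orbitOf`). The theorem then amounts to four facts.

* The sets `orbitOf i w Δ` cover all flags (`exists_mem_orbitOf`). By the Bruhat decomposition
  (`FullFlag.exists_borel_isSpannedBy`) the pair can be moved to `(x, coordinate flag of w)`. The
  elements of `borel n` that fix this flag can add to the coordinate vector `e m` multiples of the
  `e r` with `r ≤ m` and `w⁻¹ r ≤ w⁻¹ m`. Hence only the maximal elements of the support of `x` for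
  this partial order matter, and they form a decreasing sequence.
* They are disjoint (`decorated_eq_of_mem_orbitOf`). If `g` in `borel n` carries one coordinate flag
  to another, its entries force the two permutations to agree; then `g r m ≠ 0` only if `r ≤ m` and
  `w⁻¹ r ≤ w⁻¹ m`, so each of the two sets `Δ` is dominated by the other, and antichains that
  dominate each other are equal.
* The vectors `stdVec i w Δ` span a flag of `orbitOf i w Δ`
  (`IsDecorated.exists_isSpannedBy_stdVec`): with `f a` denoting the hatted or plain vector of index
  `a`, an explicit element of `borel n` sends `e a` to `f (cyc Δ a) - f a` for `a ∈ Δ \ {i}` and to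
  `f (cyc Δ a)` for the other `a`. The sum over `Δ` telescopes to `f i = e i`.
* The flags spanned by the `stdVec i w Δ` are exactly the flags in standard form
  (`IsDecorated.isStandardForm`, `FullFlag.IsStandardForm.exists_isDecorated`).
-/

namespace FlagOrbits

/-! ### Upper triangular matrices and the group `S i` -/

theorem gl_smul_e_apply {n : ℕ} (g : GL (Fin n) ℂ) (a r : Fin n) :
    (g • e a) r = g.val r a := by
  simp [gl_smul_def, e]

theorem gl_smul_eq_sum {n : ℕ} (g : GL (Fin n) ℂ) (x : Fin n → ℂ) :
    g • x = ∑ a, x a • g • e a := by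
  ext r
  simp [gl_smul_def, Finset.sum_apply, e, Matrix.mulVec, dotProduct, mul_comm]

theorem borel_diag_ne_zero {n : ℕ} {g : GL (Fin n) ℂ} (hg : g ∈ borel n) (a : Fin n) :
    g.val a a ≠ 0 := by
  have h := Matrix.det_of_isUpperTriangular (M := g.val) (fun a b hab => hg a b hab)
  have h0 : g.val.det ≠ 0 := ((Matrix.isUnit_iff_isUnit_det _).1 g.isUnit).ne_zero
  rw [h, Finset.prod_ne_zero_iff] at h0
  exact h0 a (Finset.mem_univ a)

/-- Elements of the Borel subgroup can be prescribed by their columns. -/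
theorem exists_borel_smul_e {n : ℕ} (u : Fin n → Fin n → ℂ)
    (hu : ∀ a r, a < r → u a r = 0) (hd : ∀ a, u a a ≠ 0) :
    ∃ b ∈ borel n, ∀ a, b • e a = u a := by
  have hdet : (Matrix.of fun r a => u a r).det ≠ 0 := by
    rw [Matrix.det_of_isUpperTriangular (M := Matrix.of fun r a => u a r)
      (fun a b hab => hu b a hab)]
    exact Finset.prod_ne_zero_iff.2 fun a _ => hd a
  refine ⟨Matrix.GeneralLinearGroup.mkOfDetNeZero _ hdet, fun r a har => hu a r har, fun a => ?_⟩
  ext r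
  rw [gl_smul_e_apply]
  rfl

theorem mem_S_iff {n : ℕ} {i : Fin n} {g : GL (Fin n) ℂ} :
    g ∈ S i ↔ g ∈ borel n ∧ ∃ c : ℂ, c ≠ 0 ∧ g • e i = c • e i := by
  rw [S, Subgroup.mem_inf, MulAction.mem_stabilizer_iff, Projectivization.smul_mk,
    Projectivization.mk_eq_mk_iff']
  refine and_congr_right fun _ => ⟨?_, ?_⟩
  · rintro ⟨c, hc⟩
    refine ⟨c, ?_, hc.symm⟩
    rintro rfl
    rw [zero_smul] at hc
    exact (smul_ne_zero_iff_ne g).2 (e_ne_zero i) hc.symm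
  · rintro ⟨c, -, hc⟩
    exact ⟨c, hc.symm⟩

/-! ### Flags spanned by a basis -/

theorem linearIndependent_smul_e {n : ℕ} (g : GL (Fin n) ℂ) (w : Equiv.Perm (Fin n)) :
    LinearIndependent ℂ fun p => g • e (w p) := by
  have h := ((Pi.basisFun ℂ (Fin n)).linearIndependent.map'
    (DistribMulAction.toLinearEquiv ℂ (Fin n → ℂ) g).toLinearMap (LinearEquiv.ker _)).comp w
    w.injective
  have heq : (fun p => g • e (w p)) =
      (DistribMulAction.toLinearEquiv ℂ (Fin n → ℂ) g ∘ Pi.basisFun ℂ (Fin n)) ∘ w := by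
    funext p
    simp [e]
  rw [heq]
  exact h

theorem finrank_span_initial {n : ℕ} {v : Fin n → Fin n → ℂ} (hv : LinearIndependent ℂ v)
    (k : Fin (n + 1)) :
    Module.finrank ℂ (Submodule.span ℂ (v '' {p | p.castSucc < k})) = k := by
  rw [Set.image_eq_range]
  refine (finrank_span_eq_card (hv.comp (Subtype.val : {p : Fin n | p.castSucc < k} → Fin n)
    Subtype.val_injective)).trans ?_
  have h : (Finset.univ.filter fun p : Fin n => p.castSucc < k).map Fin.castSuccEmb
      = Finset.Iio k := by
    ext q
    simp only [Finset.mem_map, Finset.mem_filter, Finset.mem_univ, true_and, Finset.mem_Iio,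
      Fin.coe_castSuccEmb]
    refine ⟨by rintro ⟨p, hp, rfl⟩; exact hp, fun hq => ?_⟩
    have hqn : q ≠ Fin.last n := (hq.trans_le (Fin.le_last k)).ne
    exact ⟨q.castPred hqn, by simpa using hq, by simp⟩
  have h2 := congrArg Finset.card h
  rw [Finset.card_map, Fin.card_Iio] at h2
  rw [← h2]
  exact Fintype.card_subtype _

namespace FullFlag

/-- The full flag spanned by a basis. -/
def ofLinearIndependent {n : ℕ} (v : Fin n → Fin n → ℂ) (hv : LinearIndependent ℂ v) :
    FullFlag n where
  V k := Submodule.span ℂ (v '' {p | p.castSucc < k})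
  mono _ _ h := Submodule.span_mono (Set.image_mono fun _ hp => lt_of_lt_of_le hp h)
  finrank_eq := finrank_span_initial hv

theorem ofLinearIndependent_isSpannedBy {n : ℕ} (v : Fin n → Fin n → ℂ)
    (hv : LinearIndependent ℂ v) : (ofLinearIndependent v hv).IsSpannedBy v := fun _ => rfl

theorem IsSpannedBy.eq {n : ℕ} {F F' : FullFlag n} {v : Fin n → Fin n → ℂ}
    (h : F.IsSpannedBy v) (h' : F'.IsSpannedBy v) : F = F' :=
  FullFlag.ext (funext fun k => (h k).trans (h' k).symm)

theorem IsSpannedBy.mem {n : ℕ} {F : FullFlag n} {v : Fin n → Fin n → ℂ}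
    (h : F.IsSpannedBy v) {p : Fin n} {k : Fin (n + 1)} (hp : p.castSucc < k) : v p ∈ F.V k := by
  rw [h k]
  exact Submodule.subset_span ⟨p, hp, rfl⟩

theorem IsSpannedBy.smul {n : ℕ} {F : FullFlag n} {v : Fin n → Fin n → ℂ}
    (h : F.IsSpannedBy v) (g : GL (Fin n) ℂ) : (g • F).IsSpannedBy fun p => g • v p := by
  intro k
  rw [smul_V, h k]
  refine (Submodule.map_span _ _).trans ?_
  rw [Set.image_image]
  rfl

theorem isSpannedBy_of_mem {n : ℕ} (F : FullFlag n) {v : Fin n → Fin n → ℂ}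
    (hv : LinearIndependent ℂ v) (hF : ∀ p, v p ∈ F.V p.succ) : F.IsSpannedBy v := by
  intro k
  symm
  apply Submodule.eq_of_le_of_finrank_eq
  · rw [Submodule.span_le]
    rintro _ ⟨p, hp, rfl⟩
    exact F.mono (Fin.castSucc_lt_iff_succ_le.1 hp) (hF p)
  · rw [finrank_span_initial hv, F.finrank_eq]

theorem IsSpannedBy.linearIndependent {n : ℕ} {F : FullFlag n} {v : Fin n → Fin n → ℂ}
    (h : F.IsSpannedBy v) : LinearIndependent ℂ v := by
  refine linearIndependent_of_top_le_span_of_card_eq_finrank (le_of_eq ?_) (by simp)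
  have h1 : F.V (Fin.last n) = ⊤ :=
    Submodule.eq_top_of_finrank_eq (by simp [F.finrank_eq])
  rw [← h1, h]
  congr 1
  ext x
  simp [Fin.castSucc_lt_last]

/-- Membership in the subspaces of the flag `b • (e (w 1) ⊂ ⋯ ⊂ e (w n))`, in coordinates. -/
theorem mem_V_iff {n : ℕ} {F : FullFlag n} {b : GL (Fin n) ℂ} {w : Equiv.Perm (Fin n)}
    (h : F.IsSpannedBy fun p => b • e (w p)) (k : Fin (n + 1)) (x : Fin n → ℂ) :
    x ∈ F.V k ↔ ∀ q : Fin n, k ≤ q.castSucc → (b⁻¹ • x) (w q) = 0 := by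
  constructor
  · intro hx q hq
    rw [h k] at hx
    induction hx using Submodule.span_induction with
    | mem x hx =>
      obtain ⟨p, hp, rfl⟩ := hx
      have hpq : w q ≠ w p := fun hpq => by
        rw [w.injective hpq] at hq
        exact absurd hp (not_lt.2 hq)
      simp [e, hpq]
    | zero => simp
    | add x y _ _ hx hy => simp [smul_add, hx, hy]
    | smul c x _ hx => simp [smul_comm b⁻¹ c x, hx]
  · intro hx
    rw [← smul_inv_smul b x, gl_smul_eq_sum]
    refine Submodule.sum_mem _ fun a _ => ?_
    obtain ⟨q, rfl⟩ := w.surjective a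
    rcases le_or_gt k q.castSucc with hq | hq
    · rw [hx q hq, zero_smul]
      exact Submodule.zero_mem _
    · exact Submodule.smul_mem _ _ (h.mem hq)

end FullFlag

/-! ### Relative position of two flags -/

namespace FullFlag

/-- The Bruhat decomposition: every flag is a `borel n`-translate of a coordinate flag. -/
theorem exists_borel_isSpannedBy {n : ℕ} (F : FullFlag n) :
    ∃ w : Equiv.Perm (Fin n), ∃ b ∈ borel n, F.IsSpannedBy fun p => b • e (w p) := by
  -- `j` is the least top coordinate of a vector in `V (p + 1) \ V p`, and `u` attains it.
  have key : ∀ p : Fin n, ∃ (j : Fin n) (u : Fin n → ℂ), u ∈ F.V p.succ ∧ u ∉ F.V p.castSucc ∧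
      (∀ r, j < r → u r = 0) ∧
      ∀ x ∈ F.V p.succ, x ∉ F.V p.castSucc → ∃ r, j ≤ r ∧ x r ≠ 0 := by
    intro p
    classical
    -- Over `ℕ`, with the strict bound `m = j + 1`, so that `m = 0` describes the zero vector.
    let P : ℕ → Prop := fun m => ∃ x ∈ F.V p.succ, x ∉ F.V p.castSucc ∧
      ∀ r : Fin n, m ≤ r.val → x r = 0
    have hn : P n := by
      have hle : ¬ F.V p.succ ≤ F.V p.castSucc := fun hle => by
        have := Submodule.finrank_mono hle
        rw [F.finrank_eq, F.finrank_eq] at this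
        simp at this
      obtain ⟨x, hx, hx'⟩ := SetLike.not_le_iff_exists.1 hle
      exact ⟨x, hx, hx', fun r hr => absurd r.isLt (not_lt.2 hr)⟩
    have hex : ∃ m, P m := ⟨n, hn⟩
    obtain ⟨u, hu, hu', hu0⟩ := Nat.find_spec hex
    have hpos : 0 < Nat.find hex := by
      rw [Nat.pos_iff_ne_zero]
      intro h0
      apply hu'
      have : u = 0 := funext fun r => hu0 r (by omega)
      rw [this]
      exact Submodule.zero_mem _
    have hlen : Nat.find hex ≤ n := Nat.find_min' hex hn
    refine ⟨⟨Nat.find hex - 1, by omega⟩, u, hu, hu', fun r hr => hu0 r ?_, fun x hx hx' => ?_⟩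
    · have : Nat.find hex - 1 < r.val := hr
      omega
    · by_contra! hcon
      exact Nat.find_min hex (m := Nat.find hex - 1) (by omega)
        ⟨x, hx, hx', fun r hr => hcon r hr⟩
  choose w u hu hu' hu0 hmin using key
  have hdiag : ∀ p, u p (w p) ≠ 0 := fun p => by
    obtain ⟨r, hr, hr0⟩ := hmin p (u p) (hu p) (hu' p)
    rcases hr.eq_or_lt with h | h
    · rwa [h]
    · exact absurd (hu0 p r h) hr0
  -- Otherwise subtracting a multiple of `u p` from `u q` would lower the top coordinate of `u q`.
  have hne : ∀ p q, p < q → w p ≠ w q := by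
    intro p q hpq heq
    have hp : u p ∈ F.V q.castSucc := F.mono (by simpa using hpq) (hu p)
    obtain ⟨r, hr, hr0⟩ := hmin q (u q - (u q (w q) / u p (w p)) • u p)
      (Submodule.sub_mem _ (hu q) (Submodule.smul_mem _ _
        (F.mono (Fin.castSucc_lt_succ).le hp)))
      (fun hmem => hu' q (by
        simpa using Submodule.add_mem _ hmem
          (Submodule.smul_mem _ (u q (w q) / u p (w p)) hp)))
    apply hr0
    rcases hr.eq_or_lt with h | h
    · rw [← h]
      have := hdiag p
      rw [Pi.sub_apply, Pi.smul_apply, smul_eq_mul, ← heq, div_mul_cancel₀ _ this, sub_self]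
    · simp [hu0 q r h, hu0 p r (heq ▸ h)]
  have hinj : Function.Injective w := fun p q hpq => by
    rcases lt_trichotomy p q with h | h | h
    · exact absurd hpq (hne p q h)
    · exact h
    · exact absurd hpq.symm (hne q p h)
  let σ : Equiv.Perm (Fin n) := Equiv.ofBijective w (Finite.injective_iff_bijective.1 hinj)
  have hσ : ∀ p, σ p = w p := fun _ => rfl
  obtain ⟨b, hb, hbe⟩ := exists_borel_smul_e (fun a => u (σ.symm a))
    (fun a r har => hu0 _ _ (by rwa [← hσ, σ.apply_symm_apply]))
    (fun a => by simpa [← hσ] using hdiag (σ.symm a))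
  refine ⟨σ, b, hb, F.isSpannedBy_of_mem (linearIndependent_smul_e b σ) fun p => ?_⟩
  rw [hbe, σ.symm_apply_apply]
  exact hu p

end FullFlag

/-- If `b • (e (w 1) ⊂ ⋯ ⊂ e (w n)) = b' • (e (w' 1) ⊂ ⋯ ⊂ e (w' n))`, then `b'⁻¹ * b` is upper
triangular with nonzero diagonal when its rows are ordered by `w'` and its columns by `w`. -/
theorem entry_of_isSpannedBy {n : ℕ} {F : FullFlag n} {b b' : GL (Fin n) ℂ}
    {w w' : Equiv.Perm (Fin n)} (h : F.IsSpannedBy fun p => b • e (w p))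
    (h' : F.IsSpannedBy fun p => b' • e (w' p)) (p : Fin n) :
    (b'⁻¹ * b).val (w' p) (w p) ≠ 0 ∧ ∀ q, p < q → (b'⁻¹ * b).val (w' q) (w p) = 0 := by
  have hz : ∀ q, p < q → (b'⁻¹ * b).val (w' q) (w p) = 0 := fun q hq => by
    rw [← gl_smul_e_apply, mul_smul]
    exact (FullFlag.mem_V_iff h' p.succ _).1 (h.mem Fin.castSucc_lt_succ) q (by simpa using hq)
  refine ⟨fun h0 => ?_, hz⟩
  have hmem : b • e (w p) ∈ F.V p.castSucc := by
    refine (FullFlag.mem_V_iff h' _ _).2 fun q hq => ?_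
    rw [← mul_smul, gl_smul_e_apply]
    rcases (show p ≤ q by simpa using hq).eq_or_lt with rfl | hlt
    · exact h0
    · exact hz q hlt
  have := (FullFlag.mem_V_iff h _ _).1 hmem p le_rfl
  simp [e] at this

theorem perm_le_of_isSpannedBy {n : ℕ} {F : FullFlag n} {b b' : GL (Fin n) ℂ}
    (hb : b ∈ borel n) (hb' : b' ∈ borel n)
    {w w' : Equiv.Perm (Fin n)} (h : F.IsSpannedBy fun p => b • e (w p))
    (h' : F.IsSpannedBy fun p => b' • e (w' p)) (p : Fin n) : w' p ≤ w p := by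
  by_contra! hlt
  exact (entry_of_isSpannedBy h h' p).1
    ((borel n).mul_mem ((borel n).inv_mem hb') hb _ _ hlt)

/-! ### The sets `orbitOf i w Δ` are disjoint, are orbits, and cover all flags -/

/-- If two sets `Δ`, `Δ'` give the same flag in `orbitOf`, with the same permutation `w`, then each
element of `Δ'` lies below one of `Δ` for the order `a ≤ a' ∧ w⁻¹ a ≤ w⁻¹ a'`. -/
theorem exists_dominating {n : ℕ} {i : Fin n} {F : FullFlag n} {b b' : GL (Fin n) ℂ}
    (hb : b ∈ borel n) (hb' : b' ∈ borel n) {w : Equiv.Perm (Fin n)} {Δ Δ' : Finset (Fin n)}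
    {c c' : ℂ} (hc' : c' ≠ 0) (hc : c ≠ 0)
    (hΔ : b • (∑ j ∈ Δ, e j) = c • e i) (hΔ' : b' • (∑ j ∈ Δ', e j) = c' • e i)
    (h : F.IsSpannedBy fun p => b • e (w p))
    (h' : F.IsSpannedBy fun p => b' • e (w p)) :
    ∀ a ∈ Δ', ∃ a' ∈ Δ, a ≤ a' ∧ w⁻¹ a ≤ w⁻¹ a' := by
  intro a ha
  have hsum : (b'⁻¹ * b) • (∑ j ∈ Δ, e j) = (c / c') • ∑ j ∈ Δ', e j := by
    rw [mul_smul, hΔ, inv_smul_eq_iff, smul_comm b', hΔ', smul_smul, div_mul_cancel₀ _ hc']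
  have hne : ∑ j ∈ Δ, (b'⁻¹ * b).val a j ≠ 0 := by
    have := congrFun hsum a
    rw [Finset.smul_sum, Finset.sum_apply] at this
    simp only [gl_smul_e_apply] at this
    rw [this]
    simp [Finset.sum_apply, e, Pi.single_apply, ha, hc, hc']
  obtain ⟨a', ha', hne'⟩ := Finset.exists_ne_zero_of_sum_ne_zero hne
  refine ⟨a', ha', ?_, ?_⟩
  · by_contra! hlt
    exact hne' ((borel n).mul_mem ((borel n).inv_mem hb') hb _ _ hlt)
  · by_contra! hlt
    have := (entry_of_isSpannedBy h h' (w⁻¹ a')).2 _ hlt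
    rw [Equiv.Perm.inv_def, Equiv.apply_symm_apply, Equiv.apply_symm_apply] at this
    exact hne' this

/-- Antichains that dominate each other are equal; this is one of the two inclusions. -/
theorem IsDecorated.subset {n : ℕ} {w : Equiv.Perm (Fin n)} {Δ Δ' : Finset (Fin n)}
    (hd : IsDecorated w Δ)
    (h : ∀ a ∈ Δ, ∃ a' ∈ Δ', a ≤ a' ∧ w⁻¹ a ≤ w⁻¹ a')
    (h' : ∀ a ∈ Δ', ∃ a' ∈ Δ, a ≤ a' ∧ w⁻¹ a ≤ w⁻¹ a') : Δ ⊆ Δ' := by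
  intro a ha
  obtain ⟨a', ha', h1, h2⟩ := h a ha
  obtain ⟨a'', ha'', h3, h4⟩ := h' a' ha'
  have : a = a'' := by
    by_contra hne
    exact absurd (hd.2 a ha a'' ha'' (lt_of_le_of_ne (h1.trans h3) hne)) (not_lt.2 (h2.trans h4))
  subst this
  rwa [le_antisymm h1 h3]

theorem decorated_eq_of_mem_orbitOf {n : ℕ} {i : Fin n} {F : FullFlag n}
    {w w' : Equiv.Perm (Fin n)} {Δ Δ' : Finset (Fin n)} (hd : IsDecorated w Δ)
    (hd' : IsDecorated w' Δ') (h : F ∈ orbitOf i w Δ) (h' : F ∈ orbitOf i w' Δ') :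
    w = w' ∧ Δ = Δ' := by
  obtain ⟨b, hb, ⟨c, hc, hbc⟩, hF⟩ := h
  obtain ⟨b', hb', ⟨c', hc', hbc'⟩, hF'⟩ := h'
  have hw : w = w' := Equiv.ext fun p =>
    le_antisymm (perm_le_of_isSpannedBy hb' hb hF' hF p) (perm_le_of_isSpannedBy hb hb' hF hF' p)
  subst hw
  have h1 := exists_dominating hb hb' hc' hc hbc hbc' hF hF'
  have h2 := exists_dominating hb' hb hc hc' hbc' hbc hF' hF
  exact ⟨rfl, (hd.subset h2 h1).antisymm (hd'.subset h1 h2)⟩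

/-- A nonempty `orbitOf i w Δ` is an orbit of `S i`. -/
theorem orbit_eq_orbitOf {n : ℕ} {i : Fin n} {F : FullFlag n} {w : Equiv.Perm (Fin n)}
    {Δ : Finset (Fin n)} (h : F ∈ orbitOf i w Δ) :
    MulAction.orbit (S i) F = orbitOf i w Δ := by
  obtain ⟨b, hb, ⟨c, hc, hbc⟩, hF⟩ := h
  ext F'
  constructor
  · rintro ⟨⟨g, hg⟩, rfl⟩
    obtain ⟨hgB, d, hd, hgd⟩ := mem_S_iff.1 hg
    refine ⟨g * b, (borel n).mul_mem hgB hb, ⟨c * d, mul_ne_zero hc hd, ?_⟩, ?_⟩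
    · rw [mul_smul, hbc, smul_comm g, hgd, smul_smul]
    · simp only [mul_smul]
      exact hF.smul g
  · rintro ⟨b', hb', ⟨c', hc', hbc'⟩, hF'⟩
    have hg : b' * b⁻¹ ∈ S i := by
      refine mem_S_iff.2 ⟨(borel n).mul_mem hb' ((borel n).inv_mem hb), c' / c,
        div_ne_zero hc' hc, ?_⟩
      have : e i = c⁻¹ • b • ∑ j ∈ Δ, e j := by rw [hbc, inv_smul_smul₀ hc]
      rw [this, mul_smul, smul_comm b⁻¹, inv_smul_smul, smul_comm b', hbc', hbc, smul_smul,
        smul_smul, smul_smul]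
      congr 1
      field_simp
    refine ⟨⟨b' * b⁻¹, hg⟩, ?_⟩
    refine FullFlag.IsSpannedBy.eq (v := fun p => b' • e (w p)) ?_ hF'
    have := hF.smul (b' * b⁻¹)
    simp only [mul_smul b' b⁻¹ (_ : Fin n → ℂ), inv_smul_smul] at this
    exact this

/-- Every flag lies in `orbitOf i w Δ` for some `i`-decorated permutation `(w, Δ)`. -/
theorem exists_mem_orbitOf {n : ℕ} (i : Fin n) (F : FullFlag n) :
    ∃ w Δ, IsDecorated w Δ ∧ IsGreatest (Δ : Set (Fin n)) i ∧ F ∈ orbitOf i w Δ := by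
  classical
  obtain ⟨w, b, hb, hF⟩ := F.exists_borel_isSpannedBy
  obtain ⟨x, hx⟩ : ∃ x : Fin n → ℂ, x = b⁻¹ • e i := ⟨_, rfl⟩
  have hxi : x i ≠ 0 := by
    rw [hx, gl_smul_e_apply]
    exact borel_diag_ne_zero ((borel n).inv_mem hb) i
  have hx0 : ∀ r, x r ≠ 0 → r ≤ i := fun r hr => by
    by_contra! hlt
    rw [hx, gl_smul_e_apply] at hr
    exact hr ((borel n).inv_mem hb _ _ hlt)
  -- The maximal elements of the support of `x`; `φ` moves each point of the support up to one.
  let Δ : Finset (Fin n) := Finset.univ.filter fun m => x m ≠ 0 ∧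
    ∀ a, x a ≠ 0 → m ≤ a → w⁻¹ m ≤ w⁻¹ a → a = m
  have hΔ : ∀ m, m ∈ Δ ↔ x m ≠ 0 ∧ ∀ a, x a ≠ 0 → m ≤ a → w⁻¹ m ≤ w⁻¹ a → a = m :=
    fun m => by simp [Δ]
  have hφ : ∀ a, ∃ m, x a ≠ 0 → m ∈ Δ ∧ a ≤ m ∧ w⁻¹ a ≤ w⁻¹ m := by
    intro a
    by_cases ha : x a = 0
    · exact ⟨a, fun h => absurd ha h⟩
    obtain ⟨m, hm, hmax⟩ := Finset.exists_max_image
      (Finset.univ.filter fun m => x m ≠ 0 ∧ a ≤ m ∧ w⁻¹ a ≤ w⁻¹ m) id ⟨a, by simp [ha]⟩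
    simp only [Finset.mem_filter, Finset.mem_univ, true_and, id] at hm hmax
    refine ⟨m, fun _ => ⟨(hΔ m).2 ⟨hm.1, fun d hd h1 h2 => ?_⟩, hm.2⟩⟩
    exact le_antisymm (hmax d ⟨hd, hm.2.1.trans h1, hm.2.2.trans h2⟩) h1
  choose φ hφ using hφ
  have hφΔ : ∀ a ∈ Δ, φ a = a := fun a ha => by
    have hxa := ((hΔ a).1 ha).1
    obtain ⟨h1, h2, h3⟩ := hφ a hxa
    exact ((hΔ a).1 ha).2 _ ((hΔ _).1 h1).1 h2 h3
  -- For `a ∈ Δ`, the part of `x` supported on the fibre of `φ` over `a` becomes the image of `e a`.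
  let y : Fin n → Fin n → ℂ := fun a r =>
    if a ∈ Δ then (if φ r = a then x r else 0) else e a r
  have hy : ∀ a r, y a r ≠ 0 → r ≤ a ∧ w⁻¹ r ≤ w⁻¹ a := by
    intro a r hr
    by_cases ha : a ∈ Δ
    · simp only [y, ha, if_true] at hr
      obtain ⟨rfl, hxr⟩ := ite_ne_right_iff.1 hr
      exact (hφ r hxr).2
    · simp only [y, ha, if_false] at hr
      have : r = a := by
        by_contra hne
        exact hr (by simp [e, hne])
      rw [this]
      exact ⟨le_rfl, le_rfl⟩
  obtain ⟨g, hg, hge⟩ := exists_borel_smul_e y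
    (fun a r har => by
      by_contra h
      exact absurd (hy a r h).1 (not_le.2 har))
    (fun a => by
      by_cases ha : a ∈ Δ
      · simpa [y, ha, hφΔ a ha] using ((hΔ a).1 ha).1
      · simp [y, ha, e])
  have hiΔ : i ∈ Δ := (hΔ i).2 ⟨hxi, fun a ha h _ => le_antisymm (hx0 a ha) h⟩
  refine ⟨w, Δ, ⟨⟨i, hiΔ⟩, fun a ha d hd hlt => ?_⟩,
    ⟨hiΔ, fun a ha => hx0 a ((hΔ a).1 ha).1⟩,
    b * g, (borel n).mul_mem hb hg, ⟨1, one_ne_zero, ?_⟩, ?_⟩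
  · by_contra! hle
    exact hlt.ne' (((hΔ a).1 ha).2 d ((hΔ d).1 hd).1 hlt.le hle)
  · have hsum : ∑ a ∈ Δ, y a = x := by
      ext r
      have : ∀ a ∈ Δ, y a r = if φ r = a then x r else 0 := fun a ha => by simp [y, ha]
      rw [Finset.sum_apply, Finset.sum_congr rfl this, Finset.sum_ite_eq]
      by_cases hr : x r = 0
      · simp [hr]
      · simp [(hφ r hr).1]
    rw [mul_smul, Finset.smul_sum]
    simp only [hge]
    rw [hsum, hx, smul_inv_smul, one_smul]
  · refine F.isSpannedBy_of_mem (linearIndependent_smul_e _ w) fun p => ?_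
    rw [mul_smul, hge, gl_smul_eq_sum]
    refine Submodule.sum_mem _ fun r _ => ?_
    by_cases hr : y (w p) r = 0
    · rw [hr, zero_smul]
      exact Submodule.zero_mem _
    · have h2 := (hy _ _ hr).2
      rw [Equiv.Perm.inv_def, Equiv.symm_apply_apply] at h2
      have := hF.mem (p := w⁻¹ r) (k := p.succ)
        (lt_of_le_of_lt (Fin.castSucc_le_castSucc_iff.2 h2) Fin.castSucc_lt_succ)
      rw [Equiv.Perm.inv_def, Equiv.apply_symm_apply] at this
      exact Submodule.smul_mem _ _ this

/-! ### The cycle of `Δ` -/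

theorem cyc_apply_of_notMem {n : ℕ} {Δ : Finset (Fin n)} {a : Fin n} (ha : a ∉ Δ) :
    cyc Δ a = a :=
  List.formPerm_apply_of_notMem (by simpa using ha)

/-- On `Δ`, the cycle sends the least element to the greatest one, and any other element to its
predecessor in `Δ`. -/
theorem cyc_apply_of_mem {n : ℕ} {Δ : Finset (Fin n)} {a : Fin n} (ha : a ∈ Δ) :
    cyc Δ a ∈ Δ ∧ ((∀ c ∈ Δ, a ≤ c ∧ c ≤ cyc Δ a) ∨
      (cyc Δ a < a ∧ ∀ c ∈ Δ, c < a → c ≤ cyc Δ a)) := by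
  have hs : (Δ.sort (· ≥ ·)).Pairwise (· ≥ ·) := Finset.pairwise_sort _ _
  have hnd : (Δ.sort (· ≥ ·)).Nodup := Finset.sort_nodup _ _
  have hmem : ∀ c, c ∈ Δ.sort (· ≥ ·) ↔ c ∈ Δ := fun c => Finset.mem_sort _
  unfold cyc
  generalize Δ.sort (· ≥ ·) = l at hs hnd hmem
  have hanti : ∀ j k (hj : j < l.length) (hk : k < l.length), j ≤ k → l[k] ≤ l[j] := by
    intro j k hj hk hjk
    rcases hjk.eq_or_lt with rfl | h
    · exact le_rfl
    · exact List.pairwise_iff_getElem.1 hs j k hj hk h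
  obtain ⟨k, hk, rfl⟩ := List.getElem_of_mem ((hmem a).2 ha)
  refine ⟨(hmem _).1 (List.formPerm_apply_mem_of_mem (List.getElem_mem hk)), ?_⟩
  rw [List.formPerm_apply_getElem l hnd k hk]
  by_cases hlt : k + 1 < l.length
  · right
    simp only [Nat.mod_eq_of_lt hlt]
    refine ⟨lt_of_le_of_ne (hanti k (k + 1) hk hlt (by omega)) fun heq => ?_, fun c hc hck => ?_⟩
    · have := (hnd.getElem_inj_iff).1 heq
      omega
    · obtain ⟨m, hm, rfl⟩ := List.getElem_of_mem ((hmem c).2 hc)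
      refine hanti (k + 1) m hlt hm ?_
      by_contra! h
      exact absurd (hanti m k hm hk (by omega)) (not_le.2 hck)
  · left
    have hkl : k + 1 = l.length := by omega
    intro c hc
    obtain ⟨m, hm, rfl⟩ := List.getElem_of_mem ((hmem c).2 hc)
    simp only [hkl, Nat.mod_self]
    exact ⟨hanti m k hm hk (by omega), hanti 0 m (by omega) hm (by omega)⟩

theorem cyc_mem_iff {n : ℕ} {Δ : Finset (Fin n)} {a : Fin n} : cyc Δ a ∈ Δ ↔ a ∈ Δ := by
  refine ⟨fun h => ?_, fun h => (cyc_apply_of_mem h).1⟩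
  by_contra ha
  exact ha (by rwa [cyc_apply_of_notMem ha] at h)

theorem cyc_symm_mem {n : ℕ} {Δ : Finset (Fin n)} {a : Fin n} (ha : a ∈ Δ) :
    (cyc Δ).symm a ∈ Δ := cyc_mem_iff.1 (by simpa using ha)

theorem cyc_lt {n : ℕ} {i : Fin n} {Δ : Finset (Fin n)}
    (hi : IsGreatest (Δ : Set (Fin n)) i) {a : Fin n} (ha : a ∈ Δ) (hne : cyc Δ a ≠ i) :
    cyc Δ a < a ∧ ∀ c ∈ Δ, c < a → c ≤ cyc Δ a := by
  obtain ⟨hmem, h | h⟩ := cyc_apply_of_mem ha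
  · exact absurd (le_antisymm (hi.2 hmem) (h i hi.1).2) hne
  · exact h

theorem le_of_cyc_eq {n : ℕ} {i : Fin n} {Δ : Finset (Fin n)}
    (hi : IsGreatest (Δ : Set (Fin n)) i) {a : Fin n} (ha : a ∈ Δ) (heq : cyc Δ a = i)
    {c : Fin n} (hc : c ∈ Δ) : a ≤ c := by
  obtain ⟨-, h | h⟩ := cyc_apply_of_mem ha
  · exact (h c hc).1
  · exact absurd h.1 (not_lt.2 (heq ▸ hi.2 ha))

/-! ### The flag of a decorated permutation -/

/-- The vector of index `a` in a standard form: the hat vector if `a ∈ Δ \ {i}`, and `e a`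
otherwise. -/
def tagged {n : ℕ} (i : Fin n) (Δ : Finset (Fin n)) (a : Fin n) : Fin n → ℂ :=
  if a ∈ Δ ∧ a ≠ i then hat i a else e a

theorem stdVec_eq_tagged {n : ℕ} (i : Fin n) (w : Equiv.Perm (Fin n)) (Δ : Finset (Fin n))
    (p : Fin n) : stdVec i w Δ p = tagged i Δ (cyc Δ (w p)) := rfl

/-- The element of the Borel subgroup that carries the line through `∑ j ∈ Δ, e j` to `[e i]` and
the coordinate flag of `w` to the flag spanned by `stdVec i w Δ`. -/
theorem exists_borel_smul_e_eq_tagged {n : ℕ} {i : Fin n} {Δ : Finset (Fin n)}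
    (hi : IsGreatest (Δ : Set (Fin n)) i) :
    ∃ b ∈ borel n, ∀ a, b • e a =
      tagged i Δ (cyc Δ a) - if a ∈ Δ ∧ a ≠ i then tagged i Δ a else 0 := by
  set u : Fin n → Fin n → ℂ := fun a =>
    tagged i Δ (cyc Δ a) - if a ∈ Δ ∧ a ≠ i then tagged i Δ a else 0 with hu
  -- The terms `e i` cancel for `a ∈ Δ \ {i}`, which makes the matrix upper triangular.
  have key : ∀ a, u a = e a ∨ u a = - e a ∨
      ∃ c < a, u a = e c + e a ∨ u a = e c - e a := by
    intro a
    by_cases ha : a ∈ Δ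
    · have hc := (cyc_apply_of_mem ha).1
      by_cases hai : a = i
      · subst hai
        by_cases hci : cyc Δ a = a
        · left
          simp [hu, hci, tagged]
        · right; right
          refine ⟨cyc Δ a, lt_of_le_of_ne (hi.2 hc) hci, Or.inl ?_⟩
          simp [hu, hci, hc, tagged, hat]
      · by_cases hci : cyc Δ a = i
        · right; left
          simp [hu, hci, hai, ha, tagged, hat]
        · right; right
          refine ⟨cyc Δ a, (cyc_lt hi ha hci).1, Or.inr ?_⟩
          simp [hu, hci, hc, ha, hai, tagged, hat]
    · left
      simp [hu, ha, cyc_apply_of_notMem ha, tagged]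
  refine exists_borel_smul_e u (fun a r har => ?_) fun a => ?_
  · rcases key a with h | h | ⟨c, hc, h | h⟩ <;> rw [h] <;>
      simp [e, har.ne']
    all_goals exact Pi.single_eq_of_ne (hc.trans har).ne' _
  · rcases key a with h | h | ⟨c, hc, h | h⟩ <;> rw [h] <;>
      simp [e]
    all_goals simp [hc.ne']

/-- The vectors `stdVec i w Δ` form a basis, whose flag lies in `orbitOf i w Δ`. -/
theorem IsDecorated.exists_isSpannedBy_stdVec {n : ℕ} {i : Fin n} {w : Equiv.Perm (Fin n)}
    {Δ : Finset (Fin n)} (hd : IsDecorated w Δ) (hi : IsGreatest (Δ : Set (Fin n)) i) :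
    ∃ F : FullFlag n, F.IsSpannedBy (stdVec i w Δ) ∧ F ∈ orbitOf i w Δ := by
  obtain ⟨b, hb, hbe⟩ := exists_borel_smul_e_eq_tagged hi
  have htag : ∀ a, tagged i Δ a = stdVec i w Δ (w⁻¹ ((cyc Δ).symm a)) := fun a => by
    simp [stdVec_eq_tagged]
  have hli : LinearIndependent ℂ (stdVec i w Δ) := by
    refine linearIndependent_of_top_le_span_of_card_eq_finrank (fun x _ => ?_) (by simp)
    have hmem : ∀ a, tagged i Δ a ∈ Submodule.span ℂ (Set.range (stdVec i w Δ)) := fun a => by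
      rw [htag]
      exact Submodule.subset_span ⟨_, rfl⟩
    rw [← smul_inv_smul b x, gl_smul_eq_sum]
    refine Submodule.sum_mem _ fun a _ => Submodule.smul_mem _ _ ?_
    rw [hbe]
    refine Submodule.sub_mem _ (hmem _) ?_
    split_ifs
    · exact hmem _
    · exact Submodule.zero_mem _
  have hF := FullFlag.ofLinearIndependent_isSpannedBy _ hli
  refine ⟨_, hF, b, hb, ⟨1, one_ne_zero, ?_⟩, ?_⟩
  · rw [Finset.smul_sum]
    simp only [hbe]
    -- `cyc Δ` permutes `Δ`, so the sum telescopes to the term `tagged i Δ i = e i`.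
    have h1 : ∑ a ∈ Δ, tagged i Δ (cyc Δ a) = ∑ a ∈ Δ, tagged i Δ a :=
      Finset.sum_equiv (cyc Δ) (fun _ => cyc_mem_iff.symm) fun _ _ => rfl
    rw [Finset.sum_sub_distrib, h1, ← Finset.sum_sub_distrib,
      Finset.sum_eq_single_of_mem i hi.1 fun a ha hai => by simp [ha, hai]]
    simp [tagged]
  · refine FullFlag.isSpannedBy_of_mem _ (linearIndependent_smul_e b w) fun p => ?_
    rw [hbe]
    refine Submodule.sub_mem _ (hF.mem Fin.castSucc_lt_succ) ?_
    split_ifs with h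
    · rw [htag]
      refine hF.mem (lt_trans ?_ Fin.castSucc_lt_succ)
      -- `w p` is the image under `cyc Δ` of a larger element of `Δ`, which `w⁻¹` puts before `p`.
      have ha := cyc_symm_mem h.1
      have hlt := (cyc_lt hi ha (by simpa using h.2)).1
      have := hd.2 _ (by simpa using h.1) _ ha hlt
      simpa using this
    · exact Submodule.zero_mem _

/-! ### Flags in standard form -/

theorem e_injective {n : ℕ} : Function.Injective (e : Fin n → Fin n → ℂ) := by
  intro a c h
  by_contra hne
  have := congrFun h a
  simp [e, hne] at this

theorem hat_injective {n : ℕ} (i : Fin n) : Function.Injective (hat i) := fun _ _ h =>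
  e_injective (add_right_cancel h)

theorem hat_ne_e {n : ℕ} {i a : Fin n} (ha : a ≠ i) (c : Fin n) : hat i a ≠ e c := by
  intro h
  have h1 := congrFun h a
  have h2 := congrFun h i
  by_cases hac : a = c
  · subst hac
    simp [hat, e] at h2
  · simp [hat, e, ha, hac] at h1

theorem stdVec_eq_e_iff {n : ℕ} {i : Fin n} {w : Equiv.Perm (Fin n)} {Δ : Finset (Fin n)}
    {p c : Fin n} : stdVec i w Δ p = e c ↔
      cyc Δ (w p) = c ∧ ¬ (cyc Δ (w p) ∈ Δ ∧ cyc Δ (w p) ≠ i) := by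
  unfold stdVec
  split_ifs with h
  · simp [h, hat_ne_e h.2]
  · simp only [e_injective.eq_iff]
    tauto

theorem stdVec_eq_hat_iff {n : ℕ} {i : Fin n} {w : Equiv.Perm (Fin n)} {Δ : Finset (Fin n)}
    {p c : Fin n} (hc : c ≠ i) : stdVec i w Δ p = hat i c ↔ cyc Δ (w p) = c ∧ c ∈ Δ := by
  unfold stdVec
  split_ifs with h
  · rw [(hat_injective i).eq_iff]
    exact ⟨fun h' => ⟨h', h' ▸ h.1⟩, fun h' => h'.1⟩
  · simp only [(hat_ne_e hc _).symm, false_iff]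
    rintro ⟨rfl, h'⟩
    exact h ⟨h', hc⟩

/-- The flag spanned by the vectors `stdVec i w Δ` is in `i`-standard form. -/
theorem IsDecorated.isStandardForm {n : ℕ} {i : Fin n} {w : Equiv.Perm (Fin n)}
    {Δ : Finset (Fin n)} (hd : IsDecorated w Δ) (hi : IsGreatest (Δ : Set (Fin n)) i)
    {F : FullFlag n} (hF : F.IsSpannedBy (stdVec i w Δ)) : F.IsStandardForm i := by
  refine ⟨_, hF, fun k => ?_, ⟨w⁻¹ ((cyc Δ).symm i), ?_⟩, fun k hk l hkl => ?_, ?_⟩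
  · by_cases h : cyc Δ (w k) ∈ Δ ∧ cyc Δ (w k) ≠ i
    · exact Or.inr ⟨cyc Δ (w k), lt_of_le_of_ne (hi.2 h.1) h.2, by simp [stdVec, h]⟩
    · exact Or.inl ⟨cyc Δ (w k), by simp only [stdVec, if_neg h]⟩
  · rw [stdVec_eq_e_iff]
    simp
  · have hki := (stdVec_eq_e_iff.1 hk).1
    have hkΔ : w k ∈ Δ := cyc_mem_iff.1 (hki ▸ hi.1)
    refine ⟨cyc Δ (w l), stdVec_eq_e_iff.2 ⟨rfl, fun h => ?_⟩⟩
    have hlΔ := cyc_mem_iff.1 h.1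
    have hle := le_of_cyc_eq hi hkΔ hki hlΔ
    have hlt : w k < w l := lt_of_le_of_ne hle fun heq => hkl.ne (w.injective heq)
    have := hd.2 _ hkΔ _ hlΔ hlt
    simp at this
    exact absurd this (not_lt.2 hkl.le)
  · intro l k hlk a ha b hb hl hk
    obtain ⟨rfl, ha'⟩ := (stdVec_eq_hat_iff ha.ne).1 hl
    obtain ⟨rfl, hb'⟩ := (stdVec_eq_hat_iff hb.ne).1 hk
    have hlΔ := cyc_mem_iff.1 ha'
    have hkΔ := cyc_mem_iff.1 hb'
    have hlt : w k < w l := by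
      by_contra! hle
      have hlt : w l < w k := lt_of_le_of_ne hle fun heq => hlk.ne (w.injective heq)
      have := hd.2 _ hlΔ _ hkΔ hlt
      simp at this
      exact absurd this (not_lt.2 hlk.le)
    exact (cyc_lt hi hkΔ hb.ne).1.trans_le ((cyc_lt hi hlΔ ha.ne).2 _ hkΔ hlt)

/-- Every flag in standard form comes from an `i`-decorated permutation: with `σ` the permutation of
the indices of its vectors and `Δ` consisting of `i` and the indices of the hat vectors, take
`w = (cyc Δ)⁻¹ * σ`. -/
theorem FullFlag.IsStandardForm.exists_isDecorated {n : ℕ} {i : Fin n} {F : FullFlag n}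
    (h : F.IsStandardForm i) : ∃ w Δ, IsDecorated w Δ ∧ IsGreatest (Δ : Set (Fin n)) i ∧
      F.IsSpannedBy (stdVec i w Δ) := by
  classical
  obtain ⟨v, hF, hv, ⟨m, hm⟩, hafter, hhat⟩ := h
  have hli := hF.linearIndependent
  have hinj := hli.injective
  -- Since `e i` occurs, the relation `hat i j = e j + e i` excludes that both of the others do.
  have hdisj : ∀ j < i, ∀ p q, v p = e j → v q ≠ hat i j := by
    intro j hj p q hp hq
    have hpq : p ≠ q := fun h => hat_ne_e hj.ne j (by rw [← hq, ← h, hp])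
    have hpm : p ≠ m := fun h => hj.ne (e_injective (by rw [← hp, h, hm]))
    have hqm : q ≠ m := fun h => hat_ne_e hj.ne i (by rw [← hq, h, hm])
    have hnot := hli.notMem_span_image (s := {p, m}) (x := q) (by simp [hpq.symm, hqm])
    apply hnot
    rw [hq, hat, ← hp, ← hm]
    exact Submodule.add_mem _ (Submodule.subset_span ⟨p, by simp, rfl⟩)
      (Submodule.subset_span ⟨m, by simp, rfl⟩)
  have hσ : ∀ k, ∃ j, v k = e j ∨ (j < i ∧ v k = hat i j) := fun k => by
    rcases hv k with ⟨j, hj⟩ | ⟨j, hj, hj'⟩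
    exacts [⟨j, Or.inl hj⟩, ⟨j, Or.inr ⟨hj, hj'⟩⟩]
  choose s hs using hσ
  have hsinj : Function.Injective s := by
    intro p q hpq
    rcases hs p with hp | ⟨hpi, hp⟩ <;> rcases hs q with hq | ⟨hqi, hq⟩
    · exact hinj (by rw [hp, hq, hpq])
    · exact absurd hq (hdisj _ hqi p q (hpq ▸ hp))
    · exact absurd hp (hdisj _ hpi q p (hpq ▸ hq))
    · exact hinj (by rw [hp, hq, hpq])
  let σ : Equiv.Perm (Fin n) := Equiv.ofBijective s (Finite.injective_iff_bijective.1 hsinj)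
  have hσs : ∀ p, σ p = s p := fun _ => rfl
  have hsm : σ m = i := by
    rcases hs m with h | ⟨h, h'⟩
    · exact e_injective (by rw [hσs, ← h, hm])
    · exact absurd (h'.symm.trans hm) (hat_ne_e h.ne i)
  let Δ : Finset (Fin n) := Finset.univ.filter fun j => j = i ∨ (j < i ∧ v (σ.symm j) = hat i j)
  have hΔ : ∀ j, j ∈ Δ ↔ j = i ∨ (j < i ∧ v (σ.symm j) = hat i j) := fun j => by simp [Δ]
  have hi : IsGreatest (Δ : Set (Fin n)) i := by
    refine ⟨(hΔ i).2 (Or.inl rfl), fun j hj => ?_⟩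
    rcases (hΔ j).1 hj with rfl | h
    exacts [le_rfl, h.1.le]
  have hstd : stdVec i (σ.trans (cyc Δ).symm) Δ = v := by
    funext p
    have hc : cyc Δ ((σ.trans (cyc Δ).symm) p) = s p := by simp [hσs]
    rw [stdVec_eq_tagged, hc, tagged]
    split_ifs with h
    · rcases (hΔ _).1 h.1 with h' | h'
      · exact absurd h' h.2
      · rw [← h'.2, ← hσs, σ.symm_apply_apply]
    · rcases hs p with h' | ⟨h', h''⟩
      · exact h'.symm
      · refine absurd ⟨(hΔ _).2 (Or.inr ⟨h', ?_⟩), h'.ne⟩ h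
        rw [← hσs, σ.symm_apply_apply, h'', hσs]
  refine ⟨σ.trans (cyc Δ).symm, Δ, ⟨⟨i, hi.1⟩, fun a ha b hb hab => ?_⟩, hi, hstd ▸ hF⟩
  have hinv : ∀ c, (σ.trans (cyc Δ).symm)⁻¹ c = σ.symm (cyc Δ c) := fun _ => rfl
  rw [hinv, hinv]
  have hcb := (cyc_apply_of_mem hb).1
  have hbi : cyc Δ b ≠ i := fun h => absurd hab (not_lt.2 (le_of_cyc_eq hi hb h ha))
  have hble := (cyc_lt hi hb hbi).2 a ha hab
  obtain ⟨hbi', hbv⟩ := ((hΔ _).1 hcb).resolve_left hbi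
  have hne : σ.symm (cyc Δ b) ≠ σ.symm (cyc Δ a) := by simpa using hab.ne'
  refine lt_of_le_of_ne (le_of_not_gt fun hlt => ?_) hne
  -- The vector of index `cyc Δ b` is hatted; that of index `cyc Δ a` is `e i` if `a` is the least
  -- element of `Δ`, and hatted otherwise.
  by_cases hai : cyc Δ a = i
  · rw [hai, ← hsm, σ.symm_apply_apply] at hlt
    obtain ⟨j, hj⟩ := hafter m hm _ hlt
    exact hat_ne_e hbi j (hbv.symm.trans hj)
  · obtain ⟨hai', hav⟩ := ((hΔ _).1 (cyc_apply_of_mem ha).1).resolve_left hai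
    have h1 := hhat _ _ hlt _ hai' _ hbi' hav hbv
    exact absurd ((cyc_lt hi ha hai).1.trans_le hble) (not_lt.2 h1.le)

end FlagOrbits

theorem theorem3p5 {n : ℕ} (i : Fin n) :
    (∀ F₀ : FlagOrbits.FullFlag n, ∃! F : FlagOrbits.FullFlag n,
      F ∈ MulAction.orbit (FlagOrbits.S i) F₀ ∧ F.IsStandardForm i) ∧
    (∃ Φ : FlagOrbits.IDecorated i ≃ {F : FlagOrbits.FullFlag n // F.IsStandardForm i},
      ∀ d : FlagOrbits.IDecorated i,
        (Φ d).1.IsSpannedBy (FlagOrbits.stdVec i d.1.1 d.1.2) ∧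
        MulAction.orbit (FlagOrbits.S i) (Φ d).1 = FlagOrbits.orbitOf i d.1.1 d.1.2) := by
  have hmem : ∀ (F : FlagOrbits.FullFlag n) (w : Equiv.Perm (Fin n)) (Δ : Finset (Fin n)),
      FlagOrbits.IsDecorated w Δ → IsGreatest (Δ : Set (Fin n)) i →
      F.IsSpannedBy (FlagOrbits.stdVec i w Δ) → F ∈ FlagOrbits.orbitOf i w Δ := by
    intro F w Δ hd hi hF
    obtain ⟨F', hF', hmem⟩ := hd.exists_isSpannedBy_stdVec hi
    rwa [hF.eq hF']
  refine ⟨fun F₀ => ?_, ?_⟩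
  · obtain ⟨w, Δ, hd, hi, hF₀⟩ := FlagOrbits.exists_mem_orbitOf i F₀
    obtain ⟨F, hF, hFmem⟩ := hd.exists_isSpannedBy_stdVec hi
    rw [FlagOrbits.orbit_eq_orbitOf hF₀]
    refine ⟨F, ⟨hFmem, hd.isStandardForm hi hF⟩, ?_⟩
    rintro F' ⟨hF'mem, hF'⟩
    obtain ⟨w', Δ', hd', hi', hF'⟩ := hF'.exists_isDecorated
    obtain ⟨rfl, rfl⟩ := FlagOrbits.decorated_eq_of_mem_orbitOf hd hd' hF'mem
      (hmem F' w' Δ' hd' hi' hF')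
    exact hF'.eq hF
  · choose f hf hf' using fun d : FlagOrbits.IDecorated i =>
      d.2.1.exists_isSpannedBy_stdVec d.2.2
    let f' : FlagOrbits.IDecorated i → {F : FlagOrbits.FullFlag n // F.IsStandardForm i} :=
      fun d => ⟨f d, d.2.1.isStandardForm d.2.2 (hf d)⟩
    have hbij : Function.Bijective f' := by
      constructor
      · intro d d' h
        have heq : f d = f d' := congrArg Subtype.val h
        obtain ⟨h1, h2⟩ := FlagOrbits.decorated_eq_of_mem_orbitOf d.2.1 d'.2.1 (hf' d)
          (heq ▸ hf' d')
        exact Subtype.ext (Prod.ext h1 h2)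
      · rintro ⟨F, hF⟩
        obtain ⟨w, Δ, hd, hi, hFs⟩ := hF.exists_isDecorated
        exact ⟨⟨(w, Δ), hd, hi⟩, Subtype.ext ((hf ⟨(w, Δ), hd, hi⟩).eq hFs)⟩
    exact ⟨Equiv.ofBijective f' hbij, fun d => ⟨hf d, FlagOrbits.orbit_eq_orbitOf (hf' d)⟩⟩
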